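/- Fix a sequence $(\mathbb T_N)_{N}$ of time grids $\mathbb T_N=\{t_0,t_1,\dots\}$, $0=t_0<t_1<\cdots$, $t_i\to\infty$ (the points depend on $N$), with $\mathbb T_1\subset\mathbb T_2\subset\cdots$ and $\lim_N\sup_{t_i\in\mathbb T_N}|t_{i+1}-t_i|=0$. For functions $\boldsymbol\xi,\boldsymbol X:[0,\infty)\to\mathbb R^d$ the pathwise Itô integral is $$\int_0^t\boldsymbol\xi_s\,d\boldsymbol X_s:=\lim_{N\uparrow\infty}\sum_{t_i,t_{i+1}\in\mathbb T_N,\ t_{i+1}\le t}\boldsymbol\xi_{t_i}\cdot(\boldsymbol X_{t_{i+1}}-\boldsymbol X_{t_i}),$$ provided the limit exists. Let $C^{1,2}(\mathbb R^n\times\mathbb R^d)$ be the class of functions $f(\boldsymbol a,\boldsymbol x)$ that are continuously differentiable in $(\boldsymbol a,\boldsymbol x)$ and twice differentiable in $\boldsymbol x$ with second partial derivatives $f_{x^kx^m}$ that are continuous in $(\boldsymbol a,\boldsymbol x)$. A function $\boldsymbol\xi:[0,\infty)\to\mathbb R^d$ is called an admissible integrand for $\boldsymbol X:[0,\infty)\to\mathbb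 R^d$ if for each $S>0$ there are $n\in\mathbb N$, $f\in C^{1,2}(\mathbb R^n\times\mathbb R^d)$ and a continuous function $\boldsymbol A:[0,\infty)\to\mathbb R^n$ whose components are of finite variation on $[0,S]$ such that $\boldsymbol\xi_t=\nabla_{\boldsymbol x}f(\boldsymbol A_t,\boldsymbol X_t)$ for $0\le t\le S$. **Theorem (associativity of the pathwise Itô integral).** Let $\boldsymbol X:[0,\infty)\to\mathbb R^d$ be continuous, and suppose that for all $k,m\in\{1,\dots,d\}$ and $t\ge 0$ the limit $$[X^k,X^m]_t=\lim_{N\uparrow\infty}\sum_{t_i,t_{i+1}\in\mathbb T_N,\ t_{i+1}\le t}(X^k_{t_{i+1}}-X^k_{t_i})(X^m_{t_{i+1}}-X^m_{t_i})$$ exists and is continuous in $t$. Let $\boldsymbol\xi^{(1)},\dots,\boldsymbol\xi^{(\nu)}$ be admissible integrands for $\boldsymbol X$. Then the integrals $$Y^\ell_t:=\int_0^t\boldsymbol\xi^{(\ell)}_s\,d\boldsymbol X_s,\qquad t\ge0,\ \ell=1,\dots,\nu,$$ exist. Let $\boldsymbol Y=(Y^1,\dots,Y^\nu)$, and let $\boldsymbol\eta=(\eta^1,\dots,\eta^\nu)$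 be an admissible integrand for $\boldsymbol Y$. Then $\sum_{\ell=1}^\nu\eta^\ell\boldsymbol\xi^{(\ell)}$ is an admissible integrand for $\boldsymbol X$, and for every $t\ge0$ both of the following integrals exist and $$\int_0^t\boldsymbol\eta_s\,d\boldsymbol Y_s=\int_0^t\sum_{\ell=1}^\nu\eta^\ell_s\boldsymbol\xi^{(\ell)}_s\,d\boldsymbol X_s.$$ -/

import Mathlib

open Filter Topology
open scoped NNReal

namespace PathwiseIto

/-- A time grid `0 = t_0 < t_1 < ⋯` in `[0, ∞)` with `t_i → ∞`. -/
structure TimeGrid where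
  /-- the grid point `t_i` -/
  pt : ℕ → ℝ≥0
  pt_zero : pt 0 = 0
  strictMono_pt : StrictMono pt
  tendsto_pt : Tendsto pt atTop atTop

theorem TimeGrid.finite_steps (G : TimeGrid) (t : ℝ≥0) : {i : ℕ | G.pt (i + 1) ≤ t}.Finite := by
  obtain ⟨n, hn⟩ := (G.tendsto_pt.eventually_gt_atTop t).exists
  refine (Set.finite_lt_nat n).subset fun i hi => ?_
  have h1 : G.pt (i + 1) < G.pt n := lt_of_le_of_lt hi hn
  have h2 : i + 1 < n := G.strictMono_pt.lt_iff_lt.mp h1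
  exact lt_trans (Nat.lt_succ_self i) h2

/-- The finitely many indices `i` with `t_{i+1} ≤ t`. -/
noncomputable def TimeGrid.steps (G : TimeGrid) (t : ℝ≥0) : Finset ℕ :=
  (G.finite_steps t).toFinset

/-- A refining sequence of time grids `𝕋_0 ⊆ 𝕋_1 ⊆ ⋯` whose mesh `sup_i |t_{i+1} - t_i|`
tends to zero. -/
structure GridSequence where
  /-- the `N`-th time grid -/
  grid : ℕ → TimeGrid
  refining : ∀ N, Set.range (grid N).pt ⊆ Set.range (grid (N + 1)).pt
  mesh : ∀ ε : ℝ, 0 < ε → ∀ᶠ N in atTop, ∀ i,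
    ((grid N).pt (i + 1) : ℝ) - ((grid N).pt i : ℝ) ≤ ε

/-- The sum `∑_{t_{i+1} ≤ t} (x_{t_{i+1}} - x_{t_i}) (y_{t_{i+1}} - y_{t_i})`. -/
noncomputable def covariationSum (G : TimeGrid) (x y : ℝ≥0 → ℝ) (t : ℝ≥0) : ℝ :=
  ∑ i ∈ G.steps t, (x (G.pt (i + 1)) - x (G.pt i)) * (y (G.pt (i + 1)) - y (G.pt i))

/-- `x` and `y` admit a continuous covariation `C = [x, y]` along the sequence of grids.
(For `t = 0` the sums are empty, so that `C 0 = 0`.) -/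
def HasContinuousCovariation (T : GridSequence) (x y : ℝ≥0 → ℝ) : Prop :=
  ∃ C : ℝ≥0 → ℝ, Continuous C ∧
    ∀ t, Tendsto (fun N => covariationSum (T.grid N) x y t) atTop (𝓝 (C t))

/-- `X : [0, ∞) → ℝ^d` is continuous and admits the continuous covariations `[X^k, X^m]` for all
`k` and `m`. -/
def IsIntegrator (T : GridSequence) {d : ℕ} (X : ℝ≥0 → EuclideanSpace ℝ (Fin d)) : Prop :=
  Continuous X ∧
    ∀ k m : Fin d, HasContinuousCovariation T (fun t => X t k) (fun t => X t m)

/-- The class `C^{1,2}(ℝ^n × ℝ^d)`: `f (a, x)` is continuously differentiable in `(a, x)` and twice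
differentiable in `x`, with second derivatives in `x` that are continuous in `(a, x)`. -/
def IsC12 {n d : ℕ} (f : EuclideanSpace ℝ (Fin n) → EuclideanSpace ℝ (Fin d) → ℝ) : Prop :=
  ContDiff ℝ 1 (Function.uncurry f) ∧
    (∀ a, ContDiff ℝ 2 (f a)) ∧
    Continuous (fun p : EuclideanSpace ℝ (Fin n) × EuclideanSpace ℝ (Fin d) =>
      fderiv ℝ (fderiv ℝ (f p.1)) p.2)

/-- `ξ` is an admissible integrand for `X`: on each `[0, S]` it is of the form
`ξ_t = ∇_x f (A_t, X_t)` with `f` of class `C^{1,2}` and `A` continuous with components of finite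
variation on `[0, S]`. -/
def IsAdmissible {d : ℕ} (X ξ : ℝ≥0 → EuclideanSpace ℝ (Fin d)) : Prop :=
  ∀ S : ℝ≥0, 0 < S →
    ∃ (n : ℕ) (f : EuclideanSpace ℝ (Fin n) → EuclideanSpace ℝ (Fin d) → ℝ)
      (A : ℝ≥0 → EuclideanSpace ℝ (Fin n)),
      IsC12 f ∧ Continuous A ∧
      (∀ k : Fin n, BoundedVariationOn (fun t => A t k) (Set.Icc 0 S)) ∧
      ∀ t, t ≤ S → ξ t = gradient (f (A t)) (X t)

/-- The nonanticipative Riemann sum `∑_{t_{i+1} ≤ t} ξ_{t_i} · (X_{t_{i+1}} - X_{t_i})`. -/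
noncomputable def riemannSum (G : TimeGrid) {d : ℕ} (ξ X : ℝ≥0 → EuclideanSpace ℝ (Fin d))
    (t : ℝ≥0) : ℝ :=
  ∑ i ∈ G.steps t, inner ℝ (ξ (G.pt i)) (X (G.pt (i + 1)) - X (G.pt i))

/-- The pathwise Itô integrals `∫_0^t ξ dX` exist for all `t ≥ 0`, as limits of Riemann sums. -/
def ItoIntegrable (T : GridSequence) {d : ℕ} (ξ X : ℝ≥0 → EuclideanSpace ℝ (Fin d)) : Prop :=
  ∀ t, ∃ I : ℝ, Tendsto (fun N => riemannSum (T.grid N) ξ X t) atTop (𝓝 I)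

/-- The pathwise Itô integral `∫_0^t ξ dX`, the limit of the Riemann sums along the grids. -/
noncomputable def itoIntegral (T : GridSequence) {d : ℕ} (ξ X : ℝ≥0 → EuclideanSpace ℝ (Fin d))
    (t : ℝ≥0) : ℝ :=
  limUnder atTop (fun N => riemannSum (T.grid N) ξ X t)

end PathwiseIto

open PathwiseIto

/-!
Expand `f (A, X)` by Taylor's formula over each grid interval. The increment is `∇ₓf (A, X) · ΔX`
plus continuous weights at `t_i` times increments of `A` and products of increments of `X`, up to a
negligible remainder. These increments act as discrete vector measures whose cumulative sums have
continuous limits, so continuous weights can be integrated against them. Hence an admissible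
`ξ = ∇ₓf (A, X)` has the integral `f (A, X) - B` on `[0, S]` with `B` continuous and of finite
variation: the integral is again a `C^{1,2}` function of a finite variation path and `X`, with the
same gradient `ξ` in `X`. The chain rule then shows that `∑ η^ℓ ξ^(ℓ)` is admissible.

The local errors `ΔY^ℓ - ξ^(ℓ) · ΔX` have cumulative limit zero, and this survives multiplication
by the continuous weights `η^ℓ`. So the Riemann sums of `η` along `Y` and of `∑ η^ℓ ξ^(ℓ)` along `X`
have the same limit, and no quadratic variation of `Y` enters.
-/

namespace PathwiseIto

section Grids

namespace TimeGrid

variable {E : Type*} [NormedAddCommGroup E] {G : TimeGrid} {s t : ℝ≥0} {i : ℕ}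

theorem mem_steps : i ∈ G.steps t ↔ G.pt (i + 1) ≤ t := by
  simp only [steps, Set.Finite.mem_toFinset, Set.mem_ofPred_eq]

theorem pt_le_of_mem_steps (h : i ∈ G.steps t) : G.pt i ≤ t :=
  (G.strictMono_pt i.lt_succ_self).le.trans (mem_steps.1 h)

theorem steps_zero (G : TimeGrid) : G.steps 0 = ∅ :=
  Finset.eq_empty_of_forall_notMem fun i hi =>
    (zero_le.trans_lt (G.strictMono_pt i.lt_succ_self)).not_ge (mem_steps.1 hi)

theorem steps_mono (G : TimeGrid) (h : s ≤ t) : G.steps s ⊆ G.steps t :=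
  fun _ hi => mem_steps.2 ((mem_steps.1 hi).trans h)

theorem steps_min (G : TimeGrid) (s t : ℝ≥0) : G.steps (min s t) = G.steps s ∩ G.steps t := by
  ext i
  simp only [mem_steps, Finset.mem_inter, le_min_iff]

theorem exists_steps_eq_range (G : TimeGrid) (t : ℝ≥0) :
    ∃ m, G.steps t = Finset.range m ∧ G.pt m ≤ t ∧ t < G.pt (m + 1) := by
  classical
  have hex : ∃ m, t < G.pt (m + 1) :=
    (((tendsto_add_atTop_iff_nat 1).2 G.tendsto_pt).eventually_gt_atTop t).exists
  refine ⟨Nat.find hex, ?_, ?_, Nat.find_spec hex⟩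
  · ext i
    rw [mem_steps, Finset.mem_range]
    refine ⟨fun hi => ?_, fun hi => not_lt.1 (Nat.find_min hex hi)⟩
    exact Nat.lt_of_succ_lt_succ (G.strictMono_pt.lt_iff_lt.1 (hi.trans_lt (Nat.find_spec hex)))
  · cases hm : Nat.find hex with
    | zero => exact G.pt_zero.trans_le zero_le
    | succ m => exact not_lt.1 (Nat.find_min hex (hm ▸ m.lt_succ_self))

theorem norm_sum_steps_le (G : TimeGrid) (h : t ≤ s) (w : ℕ → E) :
    ‖∑ i ∈ G.steps t, w i‖ ≤ ∑ i ∈ G.steps s, ‖w i‖ :=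
  (norm_sum_le _ _).trans
    (Finset.sum_le_sum_of_subset_of_nonneg (G.steps_mono h) fun _ _ _ => norm_nonneg _)

/-- The increment `u (t_{i+1}) - u (t_i)` of a path over the `i`-th interval of a grid. -/
def increment (G : TimeGrid) (u : ℝ≥0 → E) (i : ℕ) : E :=
  u (G.pt (i + 1)) - u (G.pt i)

theorem sum_norm_increment_le (G : TimeGrid) {u : ℝ≥0 → E}
    (hu : BoundedVariationOn u (Set.Icc 0 t)) :
    ∑ i ∈ G.steps t, ‖G.increment u i‖ ≤ (eVariationOn u (Set.Icc 0 t)).toReal := by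
  obtain ⟨m, hm, hmt, -⟩ := G.exists_steps_eq_range t
  rw [hm, ← ENNReal.ofReal_le_iff_le_toReal hu,
    ENNReal.ofReal_sum_of_nonneg fun _ _ => norm_nonneg _]
  calc ∑ i ∈ Finset.range m, ENNReal.ofReal ‖G.increment u i‖
      = ∑ i ∈ Finset.range m, edist (u (G.pt (i + 1))) (u (G.pt i)) := by
        simp only [increment, edist_dist, dist_eq_norm]
    _ ≤ eVariationOn u (Set.Icc 0 t) :=
        eVariationOn.sum_le_of_monotoneOn_Iic (G.strictMono_pt.monotone.monotoneOn _)
          fun i hi => ⟨zero_le, (G.strictMono_pt.monotone hi).trans hmt⟩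

end TimeGrid

namespace GridSequence

variable (T : GridSequence) {E : Type*} [NormedAddCommGroup E] {u : ℝ≥0 → E} {S t : ℝ≥0}

theorem tendsto_sum_increment (hu : ContinuousOn u (Set.Icc 0 S)) (ht : t ≤ S) :
    Tendsto (fun N => ∑ i ∈ (T.grid N).steps t, (T.grid N).increment u i) atTop
      (𝓝 (u t - u 0)) := by
  choose m hm hmt htm using fun N => (T.grid N).exists_steps_eq_range t
  have telescope (N : ℕ) : ∑ i ∈ (T.grid N).steps t, (T.grid N).increment u i =
      u ((T.grid N).pt (m N)) - u 0 := by
    rw [hm, ← (T.grid N).pt_zero]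
    exact Finset.sum_range_sub (fun i => u ((T.grid N).pt i)) (m N)
  have last_pt : Tendsto (fun N => (T.grid N).pt (m N)) atTop (𝓝[Set.Icc 0 S] t) := by
    refine tendsto_nhdsWithin_iff.2 ⟨Metric.tendsto_nhds.2 fun ε hε => ?_,
      Eventually.of_forall fun N => ⟨zero_le, (hmt N).trans ht⟩⟩
    filter_upwards [T.mesh (ε / 2) (half_pos hε)] with N hN
    have hlt : (t : ℝ) < (T.grid N).pt (m N + 1) := htm N
    have hle : ((T.grid N).pt (m N) : ℝ) ≤ t := hmt N
    rw [NNReal.dist_eq, abs_lt]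
    constructor <;> linarith [hN (m N)]
  simpa only [telescope, Function.comp_apply] using
    ((hu t ⟨zero_le, ht⟩).tendsto.comp last_pt).sub_const (u 0)

theorem eventually_norm_increment_le (hu : ContinuousOn u (Set.Icc 0 S)) {ε : ℝ} (hε : 0 < ε) :
    ∀ᶠ N in atTop, ∀ i ∈ (T.grid N).steps S, ‖(T.grid N).increment u i‖ ≤ ε := by
  obtain ⟨δ, hδ, h⟩ := Metric.uniformContinuousOn_iff_le.1
    (isCompact_Icc.uniformContinuousOn_of_continuous hu) ε hε
  filter_upwards [T.mesh δ hδ] with N hN i hi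
  rw [TimeGrid.increment, ← dist_eq_norm]
  refine h _ ⟨zero_le, TimeGrid.mem_steps.1 hi⟩ _ ⟨zero_le, TimeGrid.pt_le_of_mem_steps hi⟩ ?_
  have hlt : ((T.grid N).pt i : ℝ) ≤ (T.grid N).pt (i + 1) :=
    ((T.grid N).strictMono_pt i.lt_succ_self).le
  rw [NNReal.dist_eq, abs_of_nonneg (sub_nonneg.2 hlt)]
  exact hN i

end GridSequence

end Grids

section CumulativeLimits

theorem exists_tendsto_of_forall_approx {M : Type*} [PseudoMetricSpace M] [CompleteSpace M]
    {a : ℕ → M} (h : ∀ ε > 0, ∃ b l, Tendsto b atTop (𝓝 l) ∧ ∀ᶠ N in atTop, dist (a N) (b N) ≤ ε) :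
    ∃ l, Tendsto a atTop (𝓝 l) := by
  refine cauchySeq_tendsto_of_complete (Metric.cauchySeq_iff'.2 fun ε hε => ?_)
  obtain ⟨b, l, hb, hab⟩ := h (ε / 5) (by positivity)
  obtain ⟨N₀, hN₀⟩ := eventually_atTop.1
    (hab.and (Metric.tendsto_nhds.1 hb (ε / 5) (by positivity)))
  have near (N : ℕ) (hN : N₀ ≤ N) : dist (a N) l ≤ 2 * (ε / 5) := by
    linarith [dist_triangle (a N) (b N) l, (hN₀ N hN).1, (hN₀ N hN).2]
  exact ⟨N₀, fun N hN => (dist_triangle_right _ _ l).trans_lt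
    (by linarith [near N hN, near N₀ le_rfl])⟩

variable {T : GridSequence} {S : ℝ≥0} {E F : Type*} [NormedAddCommGroup E] [NormedAddCommGroup F]
  {u v w : ℕ → ℕ → E} {U V W : ℝ≥0 → E}

/-- Weights `w N i` attached to the intervals `(t_i, t_{i+1}]` of the `N`-th grid converge
cumulatively on `[0, S]` if their total mass stays bounded and their cumulative sums converge to a
continuous `W`. This is weak convergence of vector measures on `[0, S]` to one with continuous
distribution function `W`, in discrete form. -/
structure HasCumulativeLimit (T : GridSequence) (S : ℝ≥0) (w : ℕ → ℕ → E) (W : ℝ≥0 → E) :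
    Prop where
  isBoundedUnder :
    IsBoundedUnder (· ≤ ·) atTop fun N => ∑ i ∈ (T.grid N).steps S, ‖w N i‖
  tendsto : ∀ t ≤ S, Tendsto (fun N => ∑ i ∈ (T.grid N).steps t, w N i) atTop (𝓝 (W t))
  continuousOn : ContinuousOn W (Set.Icc 0 S)

theorem hasCumulativeLimit_increment (hU : ContinuousOn U (Set.Icc 0 S))
    (hU' : BoundedVariationOn U (Set.Icc 0 S)) :
    HasCumulativeLimit T S (fun N => (T.grid N).increment U) (fun t => U t - U 0) where
  isBoundedUnder := isBoundedUnder_of ⟨_, fun N => (T.grid N).sum_norm_increment_le hU'⟩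
  tendsto _ ht := T.tendsto_sum_increment hU ht
  continuousOn := hU.sub continuousOn_const

theorem hasCumulativeLimit_zero_of_tendsto
    (hw : Tendsto (fun N => ∑ i ∈ (T.grid N).steps S, ‖w N i‖) atTop (𝓝 0)) :
    HasCumulativeLimit T S w 0 where
  isBoundedUnder := hw.isBoundedUnder_le
  tendsto _ ht := squeeze_zero_norm (fun N => (T.grid N).norm_sum_steps_le ht _) hw
  continuousOn := continuousOn_const

theorem hasCumulativeLimit_zero_of_norm_le {c : ℕ → ℕ → ℝ}
    (hc : IsBoundedUnder (· ≤ ·) atTop fun N => ∑ i ∈ (T.grid N).steps S, c N i)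
    (h : ∀ ε > 0, ∀ᶠ N in atTop, ∀ i ∈ (T.grid N).steps S, ‖w N i‖ ≤ ε * c N i) :
    HasCumulativeLimit T S w 0 := by
  obtain ⟨K, hK⟩ := hc.eventually_le
  refine hasCumulativeLimit_zero_of_tendsto (Metric.tendsto_nhds.2 fun ε hε => ?_)
  filter_upwards [hK, h (ε / (|K| + 1)) (by positivity)] with N hKN hN
  rw [Real.dist_0_eq_abs, abs_of_nonneg (Finset.sum_nonneg fun _ _ => norm_nonneg _)]
  calc ∑ i ∈ (T.grid N).steps S, ‖w N i‖
      ≤ ε / (|K| + 1) * ∑ i ∈ (T.grid N).steps S, c N i :=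
        (Finset.sum_le_sum hN).trans_eq (Finset.mul_sum _ _ _).symm
    _ ≤ ε / (|K| + 1) * |K| :=
        mul_le_mul_of_nonneg_left (hKN.trans (le_abs_self K)) (by positivity)
    _ < ε / (|K| + 1) * (|K| + 1) := by gcongr; exact lt_add_one _
    _ = ε := div_mul_cancel₀ _ (by positivity)

namespace HasCumulativeLimit

theorem congr (hv : HasCumulativeLimit T S v W)
    (h : ∀ N, ∀ i ∈ (T.grid N).steps S, v N i = w N i) : HasCumulativeLimit T S w W where
  isBoundedUnder := by
    simpa only [Finset.sum_congr rfl fun i hi => congrArg norm (h _ i hi)]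
      using hv.isBoundedUnder
  tendsto t ht := by
    simpa only [Finset.sum_congr rfl fun i hi => h _ i ((T.grid _).steps_mono ht hi)]
      using hv.tendsto t ht
  continuousOn := hv.continuousOn

theorem congr_limit (hw : HasCumulativeLimit T S w V) (h : Set.EqOn W V (Set.Icc 0 S)) :
    HasCumulativeLimit T S w W where
  isBoundedUnder := hw.isBoundedUnder
  tendsto t ht := h ⟨zero_le, ht⟩ ▸ hw.tendsto t ht
  continuousOn := hw.continuousOn.congr h

theorem add (hv : HasCumulativeLimit T S v V) (hw : HasCumulativeLimit T S w W) :
    HasCumulativeLimit T S (v + w) (V + W) where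
  isBoundedUnder := (isBoundedUnder_le_add hv.isBoundedUnder hw.isBoundedUnder).mono_le <|
    Eventually.of_forall fun _ =>
      (Finset.sum_le_sum fun _ _ => norm_add_le _ _).trans_eq Finset.sum_add_distrib
  tendsto t ht := by
    simpa only [Pi.add_apply, Finset.sum_add_distrib] using (hv.tendsto t ht).add (hw.tendsto t ht)
  continuousOn := hv.continuousOn.add hw.continuousOn

theorem norm_sub_le (hu : HasCumulativeLimit T S u U) (hv : HasCumulativeLimit T S v V) {ε : ℝ}
    (h : ∀ᶠ N in atTop, ∑ i ∈ (T.grid N).steps S, ‖u N i - v N i‖ ≤ ε) {t : ℝ≥0} (ht : t ≤ S) :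
    ‖U t - V t‖ ≤ ε := by
  refine le_of_tendsto ((hu.tendsto t ht).sub (hv.tendsto t ht)).norm ?_
  filter_upwards [h] with N hN
  rw [← Finset.sum_sub_distrib]
  exact ((T.grid N).norm_sum_steps_le ht _).trans hN

theorem boundedVariationOn (hw : HasCumulativeLimit T S w W) :
    BoundedVariationOn W (Set.Icc 0 S) := by
  obtain ⟨K, hK⟩ := hw.isBoundedUnder.eventually_le
  refine ne_top_of_le_ne_top (ENNReal.ofReal_ne_top (r := K)) (iSup_le ?_)
  rintro ⟨n, p, hp, hpS⟩
  have sum_le : ∑ j ∈ Finset.range n, ‖W (p (j + 1)) - W (p j)‖ ≤ K := by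
    refine le_of_tendsto (tendsto_finsetSum _ fun j _ =>
      ((hw.tendsto _ (hpS (j + 1)).2).sub (hw.tendsto _ (hpS j).2)).norm) ?_
    filter_upwards [hK] with N hN
    set M : ℝ≥0 → ℝ := fun t => ∑ i ∈ (T.grid N).steps t, ‖w N i‖ with hM
    have norm_le (j : ℕ) : ‖∑ i ∈ (T.grid N).steps (p (j + 1)), w N i -
        ∑ i ∈ (T.grid N).steps (p j), w N i‖ ≤ M (p (j + 1)) - M (p j) := by
      have hsub := (T.grid N).steps_mono (hp j.le_succ)
      rw [hM, ← Finset.sum_sdiff_eq_sub hsub, ← Finset.sum_sdiff_eq_sub hsub]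
      exact norm_sum_le _ _
    calc _ ≤ ∑ j ∈ Finset.range n, (M (p (j + 1)) - M (p j)) :=
          Finset.sum_le_sum fun j _ => norm_le j
      _ = M (p n) - M (p 0) := Finset.sum_range_sub (fun j => M (p j)) n
      _ ≤ M (p n) := sub_le_self _ (Finset.sum_nonneg fun _ _ => norm_nonneg _)
      _ ≤ K := (Finset.sum_le_sum_of_subset_of_nonneg ((T.grid N).steps_mono (hpS n).2)
          fun _ _ _ => norm_nonneg _).trans hN
  calc ∑ j ∈ Finset.range n, edist (W (p (j + 1))) (W (p j))
      = ENNReal.ofReal (∑ j ∈ Finset.range n, ‖W (p (j + 1)) - W (p j)‖) := by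
        rw [ENNReal.ofReal_sum_of_nonneg fun _ _ => norm_nonneg _]
        simp only [edist_dist, dist_eq_norm]
    _ ≤ ENNReal.ofReal K := ENNReal.ofReal_le_ofReal sum_le

theorem ite_mem_steps (hw : HasCumulativeLimit T S w W) (s : ℝ≥0) :
    HasCumulativeLimit T S (fun N i => if i ∈ (T.grid N).steps s then w N i else 0)
      (fun t => W (min t s)) where
  isBoundedUnder := hw.isBoundedUnder.mono_le <| Eventually.of_forall fun N =>
    Finset.sum_le_sum fun i _ => by split_ifs <;> simp
  tendsto t ht := by
    simpa only [Finset.sum_ite_mem, TimeGrid.steps_min]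
      using hw.tendsto (min t s) ((min_le_left t s).trans ht)
  continuousOn := hw.continuousOn.comp (by fun_prop) fun _ ht =>
    ⟨zero_le, (min_le_left _ _).trans ht.2⟩

theorem exists_of_forall_approx [CompleteSpace E]
    (h : ∀ ε > 0, ∃ v V, HasCumulativeLimit T S v V ∧
      ∀ᶠ N in atTop, ∑ i ∈ (T.grid N).steps S, ‖u N i - v N i‖ ≤ ε) :
    ∃ U, HasCumulativeLimit T S u U := by
  have dist_le {t : ℝ≥0} (ht : t ≤ S) (N : ℕ) (v : ℕ → ℕ → E) :
      dist (∑ i ∈ (T.grid N).steps t, u N i) (∑ i ∈ (T.grid N).steps t, v N i) ≤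
        ∑ i ∈ (T.grid N).steps S, ‖u N i - v N i‖ := by
    rw [dist_eq_norm, ← Finset.sum_sub_distrib]
    exact (T.grid N).norm_sum_steps_le ht _
  have hlim (t : ℝ≥0) (ht : t ≤ S) :
      ∃ l, Tendsto (fun N => ∑ i ∈ (T.grid N).steps t, u N i) atTop (𝓝 l) :=
    exists_tendsto_of_forall_approx fun ε hε => by
      obtain ⟨v, V, hv, huv⟩ := h ε hε
      exact ⟨_, _, hv.tendsto t ht, huv.mono fun N hN => (dist_le ht N v).trans hN⟩
  choose! U hU using hlim
  refine ⟨U, ?_, hU, ?_⟩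
  · obtain ⟨v, V, hv, huv⟩ := h 1 one_pos
    refine (isBoundedUnder_le_add hv.isBoundedUnder
      (isBoundedUnder_of_eventually_le huv)).mono_le (Eventually.of_forall fun N => ?_)
    rw [Pi.add_apply, ← Finset.sum_add_distrib]
    exact Finset.sum_le_sum fun i _ => norm_le_norm_add_norm_sub' _ _
  · refine continuousOn_of_uniform_approx_of_continuousOn fun r hr => ?_
    obtain ⟨ε, hε, hεr⟩ := Metric.mem_uniformity_dist.1 hr
    obtain ⟨v, V, hv, huv⟩ := h (ε / 2) (half_pos hε)
    refine ⟨V, hv.continuousOn, fun t ht => hεr (lt_of_le_of_lt ?_ (half_lt_self hε))⟩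
    refine le_of_tendsto ((hU t ht.2).dist (hv.tendsto t ht.2)) ?_
    filter_upwards [huv] with N hN using (dist_le ht.2 N v).trans hN

theorem sum {ι : Type*} (s : Finset ι) {w : ι → ℕ → ℕ → E} {W : ι → ℝ≥0 → E}
    (h : ∀ j ∈ s, HasCumulativeLimit T S (w j) (W j)) :
    HasCumulativeLimit T S (∑ j ∈ s, w j) (∑ j ∈ s, W j) := by
  classical
  induction s using Finset.induction_on with
  | empty => exact hasCumulativeLimit_zero_of_tendsto (by simp)
  | insert j s hj ih =>
    rw [Finset.sum_insert hj, Finset.sum_insert hj]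
    exact (h j (s.mem_insert_self j)).add (ih fun k hk => h k (Finset.mem_insert_of_mem hk))

variable [NormedSpace ℝ E] [NormedSpace ℝ F]

theorem map (hw : HasCumulativeLimit T S w W) (L : E →L[ℝ] F) :
    HasCumulativeLimit T S (fun N i => L (w N i)) (fun t => L (W t)) where
  isBoundedUnder := by
    obtain ⟨K, hK⟩ := hw.isBoundedUnder.eventually_le
    refine isBoundedUnder_of_eventually_le (a := ‖L‖ * K) (hK.mono fun N hN => ?_)
    calc ∑ i ∈ (T.grid N).steps S, ‖L (w N i)‖
        ≤ ‖L‖ * ∑ i ∈ (T.grid N).steps S, ‖w N i‖ :=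
          (Finset.sum_le_sum fun _ _ => L.le_opNorm _).trans_eq (Finset.mul_sum _ _ _).symm
      _ ≤ ‖L‖ * K := mul_le_mul_of_nonneg_left hN (norm_nonneg L)
  tendsto t ht := by
    simpa only [← map_sum, Function.comp_def] using
      (L.continuous.tendsto _).comp (hw.tendsto t ht)
  continuousOn := L.continuous.comp_continuousOn hw.continuousOn

theorem sub (hv : HasCumulativeLimit T S v V) (hw : HasCumulativeLimit T S w W) :
    HasCumulativeLimit T S (v - w) (V - W) := by
  rw [sub_eq_add_neg, sub_eq_add_neg]
  exact hv.add (hw.map (-ContinuousLinearMap.id ℝ E))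

end HasCumulativeLimit

variable [NormedSpace ℝ E] [NormedSpace ℝ F]

/-- The weights `φ (jδ) (w N i)`, where `j < m` is the index with `t_{i+1} ∈ (jδ, (j+1)δ]`; they
are written as a sum over `j` so that cumulative limits can be read off termwise. -/
noncomputable def stepWeights (T : GridSequence) (φ : ℝ≥0 → E →L[ℝ] F) (δ : ℝ≥0) (m : ℕ)
    (w : ℕ → ℕ → E) (N i : ℕ) : F :=
  ∑ j ∈ Finset.range m, φ (j * δ)
    ((if i ∈ (T.grid N).steps ((j + 1) * δ) then w N i else 0) -
      if i ∈ (T.grid N).steps (j * δ) then w N i else 0)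

theorem stepWeights_eq {φ : ℝ≥0 → E →L[ℝ] F} {δ : ℝ≥0} {m j N i : ℕ} (hj : j < m)
    (hij : i ∉ (T.grid N).steps (j * δ)) (hij' : i ∈ (T.grid N).steps ((j + 1) * δ)) :
    stepWeights T φ δ m w N i = φ (j * δ) (w N i) := by
  rw [stepWeights, Finset.sum_eq_single j ?_ fun h => (h (Finset.mem_range.2 hj)).elim,
    if_neg hij, if_pos hij', sub_zero]
  intro k _ hkj
  rcases hkj.lt_or_gt with hkj | hjk
  · have hk : ((k : ℝ≥0) + 1) * δ ≤ j * δ :=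
      mul_le_mul_left (by exact_mod_cast hkj) δ
    rw [if_neg fun h => hij ((T.grid N).steps_mono hk h), if_neg fun h =>
      hij ((T.grid N).steps_mono ((mul_le_mul_left (by simp) δ).trans hk) h), sub_self, map_zero]
  · have hk : ((j : ℝ≥0) + 1) * δ ≤ k * δ :=
      mul_le_mul_left (by exact_mod_cast hjk) δ
    rw [if_pos ((T.grid N).steps_mono hk hij'), if_pos
      ((T.grid N).steps_mono (hk.trans (mul_le_mul_left (by simp) δ)) hij'), sub_self, map_zero]

theorem HasCumulativeLimit.stepWeights (hw : HasCumulativeLimit T S w W) (φ : ℝ≥0 → E →L[ℝ] F)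
    (δ : ℝ≥0) (m : ℕ) :
    HasCumulativeLimit T S (stepWeights T φ δ m w) (fun t => ∑ j ∈ Finset.range m,
      φ (j * δ) (W (min t ((j + 1) * δ)) - W (min t (j * δ)))) := by
  convert HasCumulativeLimit.sum (Finset.range m) fun j _ =>
    ((hw.ite_mem_steps ((j + 1) * δ)).sub (hw.ite_mem_steps (j * δ))).map (φ (j * δ)) using 1
  · ext N i
    simp only [PathwiseIto.stepWeights, Finset.sum_apply, Pi.sub_apply]
  · ext t
    simp only [Finset.sum_apply, Pi.sub_apply]

theorem exists_nat_mul_lt_le {K : Type*} [Semifield K] [LinearOrder K] [IsStrictOrderedRing K]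
    [FloorSemiring K] {δ x : K} (hδ : 0 < δ) (hx : 0 < x) :
    ∃ j : ℕ, j * δ < x ∧ x ≤ (j + 1) * δ := by
  obtain ⟨j, hj⟩ := Nat.exists_eq_succ_of_ne_zero (Nat.ceil_pos.2 (div_pos hx hδ)).ne'
  refine ⟨j, (lt_div_iff₀ hδ).1 (Nat.lt_ceil.1 (hj ▸ j.lt_succ_self)), (div_le_iff₀ hδ).1 ?_⟩
  exact_mod_cast hj ▸ Nat.le_ceil (x / δ)

theorem TimeGrid.dist_pt_le {G : TimeGrid} {i : ℕ} {r x : ℝ≥0}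
    (hmesh : (G.pt (i + 1) : ℝ) - G.pt i ≤ r) (hlt : x < G.pt (i + 1))
    (hle : G.pt (i + 1) ≤ x + r) :
    dist (G.pt i) x ≤ r := by
  rw [← NNReal.coe_lt_coe] at hlt
  rw [← NNReal.coe_le_coe, NNReal.coe_add] at hle
  have hmono : (G.pt i : ℝ) < G.pt (i + 1) := G.strictMono_pt i.lt_succ_self
  rw [NNReal.dist_eq, abs_le]
  constructor <;> linarith

theorem exists_stepWeights_approx {φ : ℝ≥0 → E →L[ℝ] F} (hφ : ContinuousOn φ (Set.Icc 0 S))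
    (hw : IsBoundedUnder (· ≤ ·) atTop fun N => ∑ i ∈ (T.grid N).steps S, ‖w N i‖)
    {ε : ℝ} (hε : 0 < ε) :
    ∃ δ m, ∀ᶠ N in atTop, ∑ i ∈ (T.grid N).steps S,
      ‖φ ((T.grid N).pt i) (w N i) - stepWeights T φ δ m w N i‖ ≤ ε := by
  obtain ⟨K, hK⟩ := hw.eventually_le
  have hK1 : 0 < |K| + 1 := by positivity
  obtain ⟨δ, hδ, h⟩ := Metric.uniformContinuousOn_iff_le.1
    (isCompact_Icc.uniformContinuousOn_of_continuous hφ) (ε / (|K| + 1)) (by positivity)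
  lift δ to ℝ≥0 using hδ.le
  obtain ⟨m, hm⟩ := exists_nat_ge (S / δ)
  replace hm : S ≤ m * δ := (div_le_iff₀ hδ).1 hm
  refine ⟨δ, m, ?_⟩
  filter_upwards [hK, T.mesh δ hδ] with N hKN hN
  have weight_le (i : ℕ) (hi : i ∈ (T.grid N).steps S) :
      ‖φ ((T.grid N).pt i) (w N i) - stepWeights T φ δ m w N i‖ ≤ ε / (|K| + 1) * ‖w N i‖ := by
    obtain ⟨j, hjlt, hjle⟩ := exists_nat_mul_lt_le (K := ℝ≥0) hδ
      (zero_le.trans_lt ((T.grid N).strictMono_pt i.lt_succ_self))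
    have hiS := TimeGrid.mem_steps.1 hi
    have hjm : j < m :=
      Nat.cast_lt.1 (lt_of_mul_lt_mul_right ((hjlt.trans_le hiS).trans_le hm) hδ.le)
    rw [stepWeights_eq hjm (TimeGrid.mem_steps.not.2 hjlt.not_ge) (TimeGrid.mem_steps.2 hjle),
      ← sub_apply]
    refine (ContinuousLinearMap.le_opNorm _ _).trans
      (mul_le_mul_of_nonneg_right ?_ (norm_nonneg _))
    rw [← dist_eq_norm]
    exact h _ ⟨zero_le, TimeGrid.pt_le_of_mem_steps hi⟩ _ ⟨zero_le, (hjlt.trans_le hiS).le⟩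
      (TimeGrid.dist_pt_le (hN i) hjlt (by rwa [add_one_mul] at hjle))
  calc _ ≤ ε / (|K| + 1) * ∑ i ∈ (T.grid N).steps S, ‖w N i‖ :=
        (Finset.sum_le_sum weight_le).trans_eq (Finset.mul_sum _ _ _).symm
    _ ≤ ε / (|K| + 1) * (|K| + 1) := by gcongr; linarith [le_abs_self K]
    _ = ε := div_mul_cancel₀ _ hK1.ne'

namespace HasCumulativeLimit

theorem exists_clm_apply [CompleteSpace F] {φ : ℝ≥0 → E →L[ℝ] F}
    (hφ : ContinuousOn φ (Set.Icc 0 S)) (hw : HasCumulativeLimit T S w W) :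
    ∃ U, HasCumulativeLimit T S (fun N i => φ ((T.grid N).pt i) (w N i)) U :=
  exists_of_forall_approx fun _ hε =>
    let ⟨δ, m, h⟩ := exists_stepWeights_approx hφ hw.isBoundedUnder hε
    ⟨_, _, hw.stepWeights φ δ m, h⟩

theorem clm_apply_zero [CompleteSpace F] {φ : ℝ≥0 → E →L[ℝ] F}
    (hφ : ContinuousOn φ (Set.Icc 0 S)) (hw : HasCumulativeLimit T S w 0) :
    HasCumulativeLimit T S (fun N i => φ ((T.grid N).pt i) (w N i)) 0 := by
  obtain ⟨U, hU⟩ := hw.exists_clm_apply hφ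
  refine hU.congr_limit fun t ht => ?_
  refine (norm_le_zero_iff.1 (le_of_forall_gt_imp_ge_of_dense fun ε hε => ?_)).symm
  obtain ⟨δ, m, h⟩ := exists_stepWeights_approx hφ hw.isBoundedUnder hε
  simpa using hU.norm_sub_le (hw.stepWeights φ δ m) h ht.2

end HasCumulativeLimit

end CumulativeLimits

section C12

variable {E F G H E' : Type*} [NormedAddCommGroup E] [NormedSpace ℝ E] [NormedAddCommGroup F]
  [NormedSpace ℝ F] [NormedAddCommGroup G] [NormedSpace ℝ G] [NormedAddCommGroup H]
  [NormedSpace ℝ H] [NormedAddCommGroup E'] [NormedSpace ℝ E']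

/-- The class `C^{1,2}` for maps between arbitrary normed spaces, so that vector-valued `f` and
product parameter spaces can be used; `IsC12` is the special case of functions on Euclidean
spaces. -/
structure IsC12Map (f : E → F → G) : Prop where
  contDiff_uncurry : ContDiff ℝ 1 (Function.uncurry f)
  contDiff_right : ∀ a, ContDiff ℝ 2 (f a)
  continuous_fderiv_fderiv : Continuous fun p : E × F => fderiv ℝ (fderiv ℝ (f p.1)) p.2

theorem isC12_iff_isC12Map {n d : ℕ}
    {f : EuclideanSpace ℝ (Fin n) → EuclideanSpace ℝ (Fin d) → ℝ} : IsC12 f ↔ IsC12Map f :=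
  ⟨fun ⟨h₁, h₂, h₃⟩ => ⟨h₁, h₂, h₃⟩, fun ⟨h₁, h₂, h₃⟩ => ⟨h₁, h₂, h₃⟩⟩

namespace IsC12Map

variable {f : E → F → G}

theorem of_hasFDerivAt {f' : E → F → F →L[ℝ] G} {f'' : E → F → F →L[ℝ] F →L[ℝ] G}
    (hf : ContDiff ℝ 1 (Function.uncurry f)) (hf' : ∀ a x, HasFDerivAt (f a) (f' a x) x)
    (hf'' : ∀ a x, HasFDerivAt (f' a) (f'' a x) x) (hc : Continuous (Function.uncurry f'')) :
    IsC12Map f where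
  contDiff_uncurry := hf
  contDiff_right a := by
    rw [show (2 : WithTop ℕ∞) = 1 + 1 from one_add_one_eq_two.symm]
    refine (contDiff_succ_iff_hasFDerivAt (n := 1)).2 ⟨f' a, ?_, hf' a⟩
    exact contDiff_one_iff_hasFDerivAt.2 ⟨f'' a, hc.comp (Continuous.prodMk_right a), hf'' a⟩
  continuous_fderiv_fderiv := by
    have fderiv_eq (a : E) : fderiv ℝ (f a) = f' a := funext fun x => (hf' a x).fderiv
    simp only [fderiv_eq, (hf'' _ _).fderiv]
    exact hc

theorem hasFDerivAt_left (hf : IsC12Map f) (a : E) (x : F) :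
    HasFDerivAt (fun b => f b x)
      (fderiv ℝ (Function.uncurry f) (a, x) ∘L ContinuousLinearMap.inl ℝ E F) a :=
  (hf.contDiff_uncurry.differentiable one_ne_zero (a, x)).hasFDerivAt.comp
    (f := fun b => (b, x)) a (hasFDerivAt_prodMk_left a x)

theorem hasFDerivAt_right (hf : IsC12Map f) (a : E) (x : F) :
    HasFDerivAt (f a)
      (fderiv ℝ (Function.uncurry f) (a, x) ∘L ContinuousLinearMap.inr ℝ E F) x :=
  (hf.contDiff_uncurry.differentiable one_ne_zero (a, x)).hasFDerivAt.comp x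
    (hasFDerivAt_prodMk_right a x)

theorem differentiable_left (hf : IsC12Map f) (x : F) : Differentiable ℝ fun a => f a x :=
  fun a => (hf.hasFDerivAt_left a x).differentiableAt

theorem differentiable_right (hf : IsC12Map f) (a : E) : Differentiable ℝ (f a) :=
  fun x => (hf.hasFDerivAt_right a x).differentiableAt

theorem differentiable_fderiv (hf : IsC12Map f) (a : E) : Differentiable ℝ (fderiv ℝ (f a)) :=
  ((hf.contDiff_right a).fderiv_right one_add_one_eq_two.le).differentiable one_ne_zero

theorem continuous_fderiv_left (hf : IsC12Map f) :
    Continuous fun p : E × F => fderiv ℝ (fun a => f a p.2) p.1 := by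
  simp only [(hf.hasFDerivAt_left _ _).fderiv]
  exact (hf.contDiff_uncurry.continuous_fderiv one_ne_zero).clm_comp continuous_const

theorem continuous_fderiv_right (hf : IsC12Map f) :
    Continuous fun p : E × F => fderiv ℝ (f p.1) p.2 := by
  simp only [(hf.hasFDerivAt_right _ _).fderiv]
  exact (hf.contDiff_uncurry.continuous_fderiv one_ne_zero).clm_comp continuous_const

theorem of_clm (L : E × F →L[ℝ] G) : IsC12Map fun a x => L (a, x) :=
  of_hasFDerivAt L.contDiff
    (fun a x => L.hasFDerivAt.comp x (hasFDerivAt_prodMk_right a x))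
    (fun _ _ => hasFDerivAt_const _ _) continuous_const

theorem add {g : E → F → G} (hf : IsC12Map f) (hg : IsC12Map g) :
    IsC12Map fun a x => f a x + g a x :=
  of_hasFDerivAt (hf.contDiff_uncurry.add hg.contDiff_uncurry)
    (fun a x => (hf.differentiable_right a x).hasFDerivAt.add
      (hg.differentiable_right a x).hasFDerivAt)
    (fun a x => (hf.differentiable_fderiv a x).hasFDerivAt.add
      (hg.differentiable_fderiv a x).hasFDerivAt)
    (hf.continuous_fderiv_fderiv.add hg.continuous_fderiv_fderiv)

theorem sum {ι : Type*} (s : Finset ι) {f : ι → E → F → G} (hf : ∀ i ∈ s, IsC12Map (f i)) :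
    IsC12Map fun a x => ∑ i ∈ s, f i a x := by
  classical
  induction s using Finset.induction_on with
  | empty => exact of_clm 0
  | insert i s hi ih =>
    simp only [Finset.sum_insert hi]
    exact (hf i (s.mem_insert_self i)).add (ih fun j hj => hf j (Finset.mem_insert_of_mem hj))

theorem comp_left (hf : IsC12Map f) (L : E' →L[ℝ] E) : IsC12Map fun a => f (L a) where
  contDiff_uncurry := hf.contDiff_uncurry.comp (L.prodMap (.id ℝ F)).contDiff
  contDiff_right a := hf.contDiff_right (L a)
  continuous_fderiv_fderiv := hf.continuous_fderiv_fderiv.comp (L.prodMap (.id ℝ F)).continuous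

theorem comp {g : E → G → H} (hg : IsC12Map g) (hf : IsC12Map f) :
    IsC12Map fun a x => g a (f a x) := by
  have hc : Continuous fun p : E × F => (p.1, f p.1 p.2) :=
    continuous_fst.prodMk hf.contDiff_uncurry.continuous
  refine of_hasFDerivAt (hg.contDiff_uncurry.comp (contDiff_fst.prodMk hf.contDiff_uncurry))
    (fun a x => (hg.differentiable_right a _).hasFDerivAt.comp x
      (hf.differentiable_right a x).hasFDerivAt)
    (fun a x => ((hg.differentiable_fderiv a _).hasFDerivAt.comp x
      (hf.differentiable_right a x).hasFDerivAt).clm_comp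
      (hf.differentiable_fderiv a x).hasFDerivAt) ?_
  have h₁ := (ContinuousLinearMap.compL ℝ F G H).continuous.comp
    (hg.continuous_fderiv_right.comp hc)
  have h₂ := (ContinuousLinearMap.compL ℝ F G H).flip.continuous.comp hf.continuous_fderiv_right
  exact (h₁.clm_comp hf.continuous_fderiv_fderiv).add
    (h₂.clm_comp ((hg.continuous_fderiv_fderiv.comp hc).clm_comp hf.continuous_fderiv_right))

theorem sub_param (hf : IsC12Map f) : IsC12Map fun (p : E × G) x => f p.1 x - p.2 :=
  (of_clm (.snd ℝ (E × G) G - .snd ℝ E G ∘L .fst ℝ (E × G) G)).comp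
    (hf.comp_left (.fst ℝ E G))

theorem toLp {ι : Type*} [Fintype ι] {f : ι → E → F → ℝ} (hf : ∀ i, IsC12Map (f i)) :
    IsC12Map fun a x => WithLp.toLp 2 fun i => f i a x := by
  classical
  have sum_single (v : ι → ℝ) : WithLp.toLp 2 v = ∑ i, v i • EuclideanSpace.single i (1 : ℝ) := by
    ext j
    simp [Finset.sum_apply, Pi.single_apply]
  simp only [sum_single]
  exact sum _ fun i _ => (of_clm ((ContinuousLinearMap.toSpanSingleton ℝ
    (EuclideanSpace.single i (1 : ℝ))) ∘L .snd ℝ E ℝ)).comp (hf i)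

end IsC12Map

section Taylor

theorem norm_sub_sub_fderiv_sub_half_smul_le {g : F → G} (hg : ContDiff ℝ 2 g) {x y : F} {ε : ℝ}
    (h : ∀ z ∈ Metric.closedBall x ‖y - x‖,
      ‖fderiv ℝ (fderiv ℝ g) z - fderiv ℝ (fderiv ℝ g) x‖ ≤ ε) :
    ‖g y - g x - fderiv ℝ g x (y - x) -
      (1 / 2 : ℝ) • fderiv ℝ (fderiv ℝ g) x (y - x) (y - x)‖ ≤ ε * ‖y - x‖ ^ 2 := by
  set D := fderiv ℝ g with hD
  set Q := fderiv ℝ D x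
  have hconv : Convex ℝ (Metric.closedBall x ‖y - x‖) := convex_closedBall _ _
  have hx : x ∈ Metric.closedBall x ‖y - x‖ := Metric.mem_closedBall_self (norm_nonneg _)
  have hy : y ∈ Metric.closedBall x ‖y - x‖ := (dist_eq_norm y x).le
  have hε : 0 ≤ ε := (norm_nonneg (fderiv ℝ D x - Q)).trans (h x hx)
  have hsymm (v w : F) : Q v w = Q w v :=
    hg.contDiffAt.isSymmSndFDerivAt (by simp) v w
  have hDdiff : Differentiable ℝ D :=
    (hg.fderiv_right one_add_one_eq_two.le).differentiable one_ne_zero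
  have first_order (z : F) (hz : z ∈ Metric.closedBall x ‖y - x‖) :
      ‖D z - D x - Q (z - x)‖ ≤ ε * ‖y - x‖ :=
    (hconv.norm_image_sub_le_of_norm_hasFDerivWithin_le'
      (fun b _ => (hDdiff b).hasFDerivAt.hasFDerivWithinAt) h hx hz).trans
      (mul_le_mul_of_nonneg_left (mem_closedBall_iff_norm.1 hz) hε)
  have hderiv (z : F) : HasFDerivAt
      (fun z => g z - D x (z - x) - (1 / 2 : ℝ) • Q (z - x) (z - x)) (D z - D x - Q (z - x)) z := by
    have hsub : HasFDerivAt (fun z => z - x) (.id ℝ F) z := (hasFDerivAt_id z).sub_const x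
    refine (((hg.differentiable two_ne_zero z).hasFDerivAt.sub
      ((D x).hasFDerivAt.comp z hsub)).sub
      (((Q.hasFDerivAt.comp z hsub).clm_apply hsub).const_smul (1 / 2 : ℝ))).congr_fderiv ?_
    ext v
    simp only [← hD, ContinuousLinearMap.comp_id, one_div, Function.comp_apply, map_sub, smul_add,
      sub_apply, add_apply, smul_apply, ContinuousLinearMap.flip_apply, hsymm v, sub_right_inj]
    module
  have := hconv.norm_image_sub_le_of_norm_hasFDerivWithin_le
    (fun z _ => (hderiv z).hasFDerivWithinAt) first_order hx hy
  rw [pow_two, ← mul_assoc]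
  convert this using 2
  simp only [sub_self, map_zero, smul_zero, sub_zero]
  abel

/-- The error `R` in the expansion
`f (a', x') = f (a, x) + ∂ₓf (a, x) Δx + ∂ₐf (a, x) Δa + ½ ∂ₓ²f (a, x) (Δx, Δx) + R`
between `p = (a, x)` and `q = (a', x')`, of first order in the parameter and of second order
in `x`. -/
noncomputable def taylorRemainder (f : E → F → G) (p q : E × F) : G :=
  f q.1 q.2 - f p.1 p.2 - fderiv ℝ (f p.1) p.2 (q.2 - p.2)
    - fderiv ℝ (fun a => f a p.2) p.1 (q.1 - p.1)
    - (1 / 2 : ℝ) • fderiv ℝ (fderiv ℝ (f p.1)) p.2 (q.2 - p.2) (q.2 - p.2)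

theorem exists_dist_le_of_continuous {α β : Type*} [PseudoMetricSpace α] [PseudoMetricSpace β]
    {φ : α → β} (hφ : Continuous φ) {K : Set α} (hK : IsCompact K) {ε : ℝ} (hε : 0 < ε) :
    ∃ δ > 0, ∀ p ∈ K, ∀ q, dist q p ≤ δ → dist (φ q) (φ p) ≤ ε := by
  obtain ⟨δ, hδ, h⟩ := Metric.mem_uniformity_dist.1
    (hK.uniformContinuousAt_of_continuousAt φ (fun _ _ => hφ.continuousAt)
      (Metric.dist_mem_uniformity hε))
  refine ⟨δ / 2, half_pos hδ, fun p hp q hq => ?_⟩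
  rw [dist_comm]
  exact (h (by linarith [dist_comm p q]) hp).le

theorem IsC12Map.exists_norm_taylorRemainder_le {f : E → F → G} (hf : IsC12Map f)
    {K : Set (E × F)} (hK : IsCompact K) {ε : ℝ} (hε : 0 < ε) :
    ∃ δ > 0, ∀ p ∈ K, ∀ q, dist q p ≤ δ →
      ‖taylorRemainder f p q‖ ≤ ε * (‖q.1 - p.1‖ + ‖q.2 - p.2‖ ^ 2) := by
  obtain ⟨δ₁, hδ₁, h₁⟩ := exists_dist_le_of_continuous hf.continuous_fderiv_left hK hε
  obtain ⟨δ₂, hδ₂, h₂⟩ := exists_dist_le_of_continuous (β := F →L[ℝ] F →L[ℝ] G)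
    hf.continuous_fderiv_fderiv hK hε
  refine ⟨min δ₁ δ₂, lt_min hδ₁ hδ₂, ?_⟩
  rintro ⟨a, x⟩ hp ⟨a', x'⟩ hq
  obtain ⟨ha, hx⟩ := max_le_iff.1 hq
  have param_part : ‖f a' x' - f a x' - fderiv ℝ (fun a => f a x) a (a' - a)‖ ≤
      ε * ‖a' - a‖ := by
    refine (convex_closedBall a ‖a' - a‖).norm_image_sub_le_of_norm_hasFDerivWithin_le'
      (fun b _ => (hf.differentiable_left x' b).hasFDerivAt.hasFDerivWithinAt) (fun b hb => ?_)
      (Metric.mem_closedBall_self (norm_nonneg _)) (dist_eq_norm a' a).le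
    rw [← dist_eq_norm]
    refine h₁ (a, x) hp (b, x') (max_le ?_ (hx.trans (min_le_left _ _)))
    exact (Metric.mem_closedBall.1 hb).trans
      ((dist_eq_norm a' a).symm.le.trans (ha.trans (min_le_left _ _)))
  have space_part := norm_sub_sub_fderiv_sub_half_smul_le (hf.contDiff_right a)
    (x := x) (y := x') (ε := ε) fun z hz => by
      refine (dist_eq_norm (fderiv ℝ (fderiv ℝ (f a)) z) _).symm.trans_le
        (h₂ (a, x) hp (a, z) (max_le ((dist_self a).trans_le hδ₂.le) ?_))
      exact (Metric.mem_closedBall.1 hz).trans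
        ((dist_eq_norm x' x).symm.le.trans (hx.trans (min_le_right _ _)))
  calc ‖taylorRemainder f (a, x) (a', x')‖
      = ‖(f a' x' - f a x' - fderiv ℝ (fun a => f a x) a (a' - a)) +
          (f a x' - f a x - fderiv ℝ (f a) x (x' - x) -
            (1 / 2 : ℝ) • fderiv ℝ (fderiv ℝ (f a)) x (x' - x) (x' - x))‖ := by
        rw [taylorRemainder]
        congr 1
        abel
    _ ≤ ε * (‖a' - a‖ + ‖x' - x‖ ^ 2) :=
        (norm_add_le_of_le param_part space_part).trans_eq (mul_add _ _ _).symm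

end Taylor

end C12

section BoundedVariation

variable {α E F : Type*} [LinearOrder α] [NormedAddCommGroup E] [NormedAddCommGroup F] {s : Set α}

theorem boundedVariationOn_add {f g : α → E} (hf : BoundedVariationOn f s)
    (hg : BoundedVariationOn g s) : BoundedVariationOn (fun t => f t + g t) s := by
  refine ne_top_of_le_ne_top (ENNReal.add_ne_top.2 ⟨hf, hg⟩) (iSup_le fun p => ?_)
  calc ∑ i ∈ Finset.range p.1, edist (f (p.2.1 (i + 1)) + g (p.2.1 (i + 1)))
        (f (p.2.1 i) + g (p.2.1 i))
      ≤ ∑ i ∈ Finset.range p.1, edist (f (p.2.1 (i + 1))) (f (p.2.1 i)) +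
          ∑ i ∈ Finset.range p.1, edist (g (p.2.1 (i + 1))) (g (p.2.1 i)) :=
        (Finset.sum_le_sum fun _ _ => edist_add_add_le _ _ _ _).trans_eq Finset.sum_add_distrib
    _ ≤ eVariationOn f s + eVariationOn g s :=
        add_le_add (le_iSup_of_le p le_rfl) (le_iSup_of_le p le_rfl)

theorem boundedVariationOn_sum {ι : Type*} (j : Finset ι) {f : ι → α → E}
    (hf : ∀ i ∈ j, BoundedVariationOn (f i) s) :
    BoundedVariationOn (fun t => ∑ i ∈ j, f i t) s := by
  classical
  induction j using Finset.induction_on with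
  | empty => exact ne_of_eq_of_ne (eVariationOn.constant_on (Set.subsingleton_of_subset_singleton
      (Set.image_subset_iff.2 fun _ _ => Finset.sum_empty))) ENNReal.zero_ne_top
  | insert i j hi ih =>
    simp only [Finset.sum_insert hi]
    exact boundedVariationOn_add (hf i (j.mem_insert_self i))
      (ih fun k hk => hf k (Finset.mem_insert_of_mem hk))

variable [NormedSpace ℝ E] [NormedSpace ℝ F]

theorem boundedVariationOn_clm_comp {f : α → E} (hf : BoundedVariationOn f s) (L : E →L[ℝ] F) :
    BoundedVariationOn (fun t => L (f t)) s :=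
  L.lipschitz.comp_boundedVariationOn hf

theorem boundedVariationOn_prodMk {f : α → E} {g : α → F} (hf : BoundedVariationOn f s)
    (hg : BoundedVariationOn g s) : BoundedVariationOn (fun t => (f t, g t)) s := by
  simpa using boundedVariationOn_add (boundedVariationOn_clm_comp hf (.inl ℝ E F))
    (boundedVariationOn_clm_comp hg (.inr ℝ E F))

theorem boundedVariationOn_pi {ι : Type*} [Fintype ι] {E : ι → Type*}
    [∀ i, NormedAddCommGroup (E i)] [∀ i, NormedSpace ℝ (E i)] {f : ∀ i, α → E i}
    (hf : ∀ i, BoundedVariationOn (f i) s) : BoundedVariationOn (fun t i => f i t) s := by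
  classical
  simpa [Finset.univ_sum_single] using boundedVariationOn_sum Finset.univ fun i _ =>
    boundedVariationOn_clm_comp (hf i) (ContinuousLinearMap.single ℝ E i)

theorem boundedVariationOn_euclideanSpace_iff {ι : Type*} [Fintype ι]
    {f : α → EuclideanSpace ℝ ι} :
    BoundedVariationOn f s ↔ ∀ i, BoundedVariationOn (fun t => f t i) s :=
  ⟨fun hf i => boundedVariationOn_clm_comp hf (EuclideanSpace.proj i), fun hf =>
    boundedVariationOn_clm_comp (boundedVariationOn_pi hf)
      (EuclideanSpace.equiv ι ℝ).symm.toContinuousLinearMap⟩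

end BoundedVariation

section Potentials

variable {S : ℝ≥0} {E F : Type*} [NormedAddCommGroup E] [NormedSpace ℝ E]
  [NormedAddCommGroup F] [InnerProductSpace ℝ F] [CompleteSpace F]

theorem gradient_comp_toLp {ι : Type*} [Fintype ι] {g : EuclideanSpace ℝ ι → ℝ} {φ : ι → F → ℝ}
    {x : F} (hg : DifferentiableAt ℝ g (WithLp.toLp 2 fun ℓ => φ ℓ x))
    (hφ : ∀ ℓ, DifferentiableAt ℝ (φ ℓ) x) :
    gradient (fun x => g (WithLp.toLp 2 fun ℓ => φ ℓ x)) x =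
      ∑ ℓ, gradient g (WithLp.toLp 2 fun ℓ => φ ℓ x) ℓ • gradient (φ ℓ) x := by
  have hasFDerivAt_toLp : HasFDerivAt (fun x => WithLp.toLp 2 fun ℓ => φ ℓ x)
      ((EuclideanSpace.equiv ι ℝ).symm.toContinuousLinearMap ∘L
        ContinuousLinearMap.pi fun ℓ => fderiv ℝ (φ ℓ) x) x :=
    (EuclideanSpace.equiv ι ℝ).symm.hasFDerivAt.comp x
      (hasFDerivAt_pi.2 fun ℓ => (hφ ℓ).hasFDerivAt)
  have hasFDerivAt_comp : HasFDerivAt (fun x => g (WithLp.toLp 2 fun ℓ => φ ℓ x)) _ x :=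
    hg.hasFDerivAt.comp x hasFDerivAt_toLp
  refine ext_inner_right ℝ fun v => ?_
  rw [inner_gradient_left, hasFDerivAt_comp.fderiv]
  simp only [sum_inner, real_inner_smul_left, inner_gradient_left]
  rw [ContinuousLinearMap.comp_apply, ← inner_gradient_left, PiLp.inner_apply]
  exact Finset.sum_congr rfl fun ℓ _ => mul_comm _ _

/-- `f` is a potential for the integrand `ξ` along `X` with parameter path `A`: on `[0, S]` one has
`ξ = ∇ₓ f (A, X)` with `f` of class `C^{1,2}` and `A` continuous and of finite variation. The
parameter space is arbitrary, so that parameters can be joined by products. -/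
structure IsPotentialOn (S : ℝ≥0) (X ξ : ℝ≥0 → F) (f : E → F → ℝ) (A : ℝ≥0 → E) : Prop where
  isC12Map : IsC12Map f
  continuousOn : ContinuousOn A (Set.Icc 0 S)
  boundedVariationOn : BoundedVariationOn A (Set.Icc 0 S)
  eq_gradient : ∀ t ≤ S, ξ t = gradient (f (A t)) (X t)

theorem IsPotentialOn.exists_euclidean [FiniteDimensional ℝ E] {X ξ : ℝ≥0 → F} {f : E → F → ℝ}
    {A : ℝ≥0 → E} (h : IsPotentialOn S X ξ f A) :
    ∃ (n : ℕ) (f : EuclideanSpace ℝ (Fin n) → F → ℝ) (A : ℝ≥0 → EuclideanSpace ℝ (Fin n)),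
      IsPotentialOn S X ξ f A :=
  ⟨Module.finrank ℝ E, fun a => f (toEuclidean.symm a), fun t => toEuclidean (A t),
    h.isC12Map.comp_left toEuclidean.symm.toContinuousLinearMap,
    toEuclidean.continuous.comp_continuousOn h.continuousOn,
    boundedVariationOn_clm_comp h.boundedVariationOn toEuclidean.toContinuousLinearMap,
    fun t ht => by simpa only [ContinuousLinearEquiv.symm_apply_apply] using h.eq_gradient t ht⟩

theorem isAdmissible_iff {d : ℕ} {X ξ : ℝ≥0 → EuclideanSpace ℝ (Fin d)} :
    IsAdmissible X ξ ↔ ∀ S : ℝ≥0, 0 < S →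
      ∃ (n : ℕ) (f : EuclideanSpace ℝ (Fin n) → EuclideanSpace ℝ (Fin d) → ℝ)
        (A : ℝ≥0 → EuclideanSpace ℝ (Fin n)), IsPotentialOn S X ξ f A := by
  refine forall₂_congr fun S _ => ⟨?_, ?_⟩
  · rintro ⟨n, f, A, hf, hA, hA', hξ⟩
    exact ⟨n, f, A, isC12_iff_isC12Map.1 hf, hA.continuousOn,
      boundedVariationOn_euclideanSpace_iff.2 hA', hξ⟩
  · rintro ⟨n, f, A, hf, hA, hA', hξ⟩
    have stopped_eqOn : Set.EqOn (fun t => A (min t S)) A (Set.Icc 0 S) := fun t ht => by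
      simp only [min_eq_left ht.2]
    refine ⟨n, f, fun t => A (min t S), isC12_iff_isC12Map.2 hf,
      hA.comp_continuous (by fun_prop) fun t => ⟨zero_le, min_le_right _ _⟩,
      boundedVariationOn_euclideanSpace_iff.1 ?_, fun t ht => ?_⟩
    · exact ne_of_eq_of_ne (eVariationOn.eq_of_eqOn stopped_eqOn) hA'
    · rw [hξ t ht, stopped_eqOn ⟨zero_le, ht⟩]

namespace IsPotentialOn

theorem continuousOn_integrand {X ξ : ℝ≥0 → F} {f : E → F → ℝ} {A : ℝ≥0 → E}
    (h : IsPotentialOn S X ξ f A) (hX : ContinuousOn X (Set.Icc 0 S)) :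
    ContinuousOn ξ (Set.Icc 0 S) :=
  ((InnerProductSpace.toDual ℝ F).symm.continuous.comp_continuousOn
    (h.isC12Map.continuous_fderiv_right.comp_continuousOn (h.continuousOn.prodMk hX))).congr
    fun t ht => h.eq_gradient t ht.2

theorem continuousOn_apply {X ξ : ℝ≥0 → F} {f : E → F → ℝ} {A : ℝ≥0 → E}
    (h : IsPotentialOn S X ξ f A) (hX : ContinuousOn X (Set.Icc 0 S)) :
    ContinuousOn (fun t => f (A t) (X t)) (Set.Icc 0 S) :=
  h.isC12Map.contDiff_uncurry.continuous.comp_continuousOn (h.continuousOn.prodMk hX)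

theorem sum_smul {ι : Type*} [Fintype ι] {P : ι → Type*} [∀ ℓ, NormedAddCommGroup (P ℓ)]
    [∀ ℓ, NormedSpace ℝ (P ℓ)] {X : ℝ≥0 → F} {ξ : ι → ℝ≥0 → F} {f : ∀ ℓ, P ℓ → F → ℝ}
    {A : ∀ ℓ, ℝ≥0 → P ℓ} {Y η : ℝ≥0 → EuclideanSpace ℝ ι} {g : E → EuclideanSpace ℝ ι → ℝ}
    {C : ℝ≥0 → E} (hf : ∀ ℓ, IsPotentialOn S X (ξ ℓ) (f ℓ) (A ℓ))
    (hY : ∀ ℓ, ∀ t ≤ S, Y t ℓ = f ℓ (A ℓ t) (X t)) (hg : IsPotentialOn S Y η g C) :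
    IsPotentialOn S X (fun t => ∑ ℓ, η t ℓ • ξ ℓ t)
      (fun (p : E × ∀ ℓ, P ℓ) x => g p.1 (WithLp.toLp 2 fun ℓ => f ℓ (p.2 ℓ) x))
      (fun t => (C t, fun ℓ => A ℓ t)) where
  isC12Map := (hg.isC12Map.comp_left (.fst ℝ E _)).comp <| .toLp fun ℓ =>
    (hf ℓ).isC12Map.comp_left (ContinuousLinearMap.proj ℓ ∘L .snd ℝ E (∀ ℓ, P ℓ))
  continuousOn := hg.continuousOn.prodMk (continuousOn_pi.2 fun ℓ => (hf ℓ).continuousOn)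
  boundedVariationOn := boundedVariationOn_prodMk hg.boundedVariationOn
    (boundedVariationOn_pi fun ℓ => (hf ℓ).boundedVariationOn)
  eq_gradient t ht := by
    have hYt : (WithLp.toLp 2 fun ℓ => f ℓ (A ℓ t) (X t)) = Y t := by
      ext ℓ
      exact (hY ℓ t ht).symm
    rw [gradient_comp_toLp (hg.isC12Map.differentiable_right _ _)
      fun ℓ => (hf ℓ).isC12Map.differentiable_right _ _, hYt, ← hg.eq_gradient t ht]
    simp only [(hf _).eq_gradient t ht]

end IsPotentialOn

end Potentials

section QuadraticVariation

-- Instance search needs this depth for the norm on the dual of a space of bilinear maps.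
set_option maxSynthPendingDepth 3

variable {T : GridSequence} {S : ℝ≥0} {F : Type*} [NormedAddCommGroup F]

/-- The tensor `v ⊗ w`, encoded as the functional `B ↦ B v w` on bilinear forms. -/
noncomputable def tensor [NormedSpace ℝ F] (v w : F) : (F →L[ℝ] F →L[ℝ] ℝ) →L[ℝ] ℝ :=
  .apply ℝ ℝ w ∘L .apply ℝ (F →L[ℝ] ℝ) v

theorem tensor_apply [NormedSpace ℝ F] (v w : F) (β : F →L[ℝ] F →L[ℝ] ℝ) :
    tensor v w β = β v w :=
  rfl

/-- `X` has a continuous tensor-valued quadratic variation along the grids on `[0, S]`. -/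
def HasQuadraticVariationOn (T : GridSequence) (S : ℝ≥0) [NormedSpace ℝ F] (X : ℝ≥0 → F) : Prop :=
  ∃ Q, HasCumulativeLimit T S
    (fun N i => tensor ((T.grid N).increment X i) ((T.grid N).increment X i)) Q

theorem HasQuadraticVariationOn.isBoundedUnder_sum_norm_sq [InnerProductSpace ℝ F] {X : ℝ≥0 → F}
    (h : HasQuadraticVariationOn T S X) :
    IsBoundedUnder (· ≤ ·) atTop
      fun N => ∑ i ∈ (T.grid N).steps S, ‖(T.grid N).increment X i‖ ^ 2 := by
  obtain ⟨Q, hQ⟩ := h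
  have norm_tensor_innerSL (v : F) : ‖tensor v v (innerSL ℝ)‖ = ‖v‖ ^ 2 := by
    rw [tensor_apply, innerSL_apply_apply, real_inner_self_eq_norm_sq, norm_pow, norm_norm]
  simpa only [ContinuousLinearMap.apply_apply, norm_tensor_innerSL] using
    (hQ.map (.apply ℝ ℝ (innerSL ℝ))).isBoundedUnder

theorem HasQuadraticVariationOn.exists_hasCumulativeLimit [NormedSpace ℝ F] {X : ℝ≥0 → F}
    (h : HasQuadraticVariationOn T S X) {β : ℝ≥0 → F →L[ℝ] F →L[ℝ] ℝ}
    (hβ : ContinuousOn β (Set.Icc 0 S)) :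
    ∃ C, HasCumulativeLimit T S (fun N i =>
      β ((T.grid N).pt i) ((T.grid N).increment X i) ((T.grid N).increment X i)) C := by
  obtain ⟨Q, hQ⟩ := h
  exact hQ.exists_clm_apply ((ContinuousLinearMap.apply ℝ ℝ).continuous.comp_continuousOn hβ)

theorem HasContinuousCovariation.exists_hasCumulativeLimit {x y : ℝ≥0 → ℝ}
    (hx : HasContinuousCovariation T x x) (hy : HasContinuousCovariation T y y)
    (hxy : HasContinuousCovariation T x y) :
    ∃ C, HasCumulativeLimit T S
      (fun N i => (T.grid N).increment x i * (T.grid N).increment y i) C := by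
  obtain ⟨C, hC, hlim⟩ := hxy
  obtain ⟨Cx, -, hlimx⟩ := hx
  obtain ⟨Cy, -, hlimy⟩ := hy
  refine ⟨C, ?_, fun t _ => hlim t, hC.continuousOn⟩
  refine ((hlimx S).add (hlimy S)).isBoundedUnder_le.mono_le (Eventually.of_forall fun N => ?_)
  have norm_mul_le (a b : ℝ) : ‖a * b‖ ≤ a * a + b * b :=
    abs_le.2 ⟨by nlinarith [sq_nonneg (a + b)], by nlinarith [sq_nonneg (a - b)]⟩
  exact (Finset.sum_le_sum fun i _ => norm_mul_le _ _).trans_eq Finset.sum_add_distrib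

theorem IsIntegrator.hasQuadraticVariationOn {d : ℕ} {X : ℝ≥0 → EuclideanSpace ℝ (Fin d)}
    (hX : IsIntegrator T X) (S : ℝ≥0) : HasQuadraticVariationOn T S X := by
  choose C hC using fun k m =>
    (hX.2 k k).exists_hasCumulativeLimit (S := S) (hX.2 m m) (hX.2 k m)
  let e := EuclideanSpace.basisFun (Fin d) ℝ
  have tensor_eq_sum (v : EuclideanSpace ℝ (Fin d)) :
      tensor v v = ∑ k, ∑ m, (v k * v m) • tensor (e k) (e m) := by
    ext B
    conv_lhs => rw [← e.sum_repr v]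
    simp only [tensor, ContinuousLinearMap.comp_apply, ContinuousLinearMap.apply_apply, map_sum,
      map_smul, sum_apply, smul_apply, e, EuclideanSpace.basisFun_repr, smul_eq_mul,
      Finset.mul_sum, mul_assoc]
  refine ⟨_, (HasCumulativeLimit.sum Finset.univ fun k _ => .sum Finset.univ fun m _ =>
    (hC k m).map (.toSpanSingleton ℝ (tensor (e k) (e m)))).congr fun N i _ => ?_⟩
  simp only [tensor_eq_sum, Finset.sum_apply]
  rfl

end QuadraticVariation

section ItoPrimitives

variable {T : GridSequence} {S : ℝ≥0} {E F : Type*} [NormedAddCommGroup E] [NormedSpace ℝ E]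
  [NormedAddCommGroup F] [InnerProductSpace ℝ F]

theorem IsC12Map.hasCumulativeLimit_taylorRemainder {f : E → F → ℝ} (hf : IsC12Map f)
    {A : ℝ≥0 → E} {X : ℝ≥0 → F} (hA : ContinuousOn A (Set.Icc 0 S))
    (hA' : BoundedVariationOn A (Set.Icc 0 S)) (hX : ContinuousOn X (Set.Icc 0 S))
    (hXX : HasQuadraticVariationOn T S X) :
    HasCumulativeLimit T S (fun N i => taylorRemainder f
      (A ((T.grid N).pt i), X ((T.grid N).pt i))
      (A ((T.grid N).pt (i + 1)), X ((T.grid N).pt (i + 1)))) 0 := by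
  have hAX : ContinuousOn (fun t => (A t, X t)) (Set.Icc 0 S) := hA.prodMk hX
  have mass_bounded := isBoundedUnder_le_add
    (hasCumulativeLimit_increment (T := T) hA hA').isBoundedUnder hXX.isBoundedUnder_sum_norm_sq
  refine hasCumulativeLimit_zero_of_norm_le
    (c := fun N i => ‖(T.grid N).increment A i‖ + ‖(T.grid N).increment X i‖ ^ 2) ?_
    fun ε hε => ?_
  · simp only [Finset.sum_add_distrib]
    exact mass_bounded
  · obtain ⟨δ, hδ, h⟩ :=
      hf.exists_norm_taylorRemainder_le (isCompact_Icc.image_of_continuousOn hAX) hε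
    filter_upwards [T.eventually_norm_increment_le hAX hδ] with N hN i hi
    refine h _ ⟨_, ⟨zero_le, TimeGrid.pt_le_of_mem_steps hi⟩, rfl⟩ _ ?_
    rw [dist_eq_norm]
    exact hN i hi

theorem IsC12Map.exists_hasCumulativeLimit_increment_sub_fderiv {f : E → F → ℝ} (hf : IsC12Map f)
    {A : ℝ≥0 → E} {X : ℝ≥0 → F} (hA : ContinuousOn A (Set.Icc 0 S))
    (hA' : BoundedVariationOn A (Set.Icc 0 S)) (hX : ContinuousOn X (Set.Icc 0 S))
    (hXX : HasQuadraticVariationOn T S X) :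
    ∃ B, HasCumulativeLimit T S (fun N i => (T.grid N).increment (fun t => f (A t) (X t)) i -
      fderiv ℝ (f (A ((T.grid N).pt i))) (X ((T.grid N).pt i)) ((T.grid N).increment X i)) B := by
  have hAX : ContinuousOn (fun t => (A t, X t)) (Set.Icc 0 S) := hA.prodMk hX
  obtain ⟨B₁, first_order⟩ := (hasCumulativeLimit_increment hA hA').exists_clm_apply
    (T := T) (hf.continuous_fderiv_left.comp_continuousOn hAX)
  obtain ⟨B₂, second_order⟩ := hXX.exists_hasCumulativeLimit
    (β := fun t => (1 / 2 : ℝ) • fderiv ℝ (fderiv ℝ (f (A t))) (X t))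
    ((hf.continuous_fderiv_fderiv.comp_continuousOn hAX).const_smul (1 / 2 : ℝ))
  refine ⟨_, ((first_order.add second_order).add
    (hf.hasCumulativeLimit_taylorRemainder hA hA' hX hXX)).congr fun N i _ => ?_⟩
  simp only [Pi.add_apply, taylorRemainder, TimeGrid.increment, smul_apply, Function.comp_apply]
  ring

/-- `I` is a primitive of `ξ` along `X` on `[0, S]`: `I` starts at `0`, is continuous, and the total
error of the approximations `I (t_{i+1}) - I (t_i) ≈ ξ (t_i) · (X (t_{i+1}) - X (t_i))` vanishes in
the cumulative sense. -/
structure IsItoPrimitiveOn (T : GridSequence) (S : ℝ≥0) (ξ X : ℝ≥0 → F) (I : ℝ≥0 → ℝ) : Prop where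
  map_zero : I 0 = 0
  continuousOn : ContinuousOn I (Set.Icc 0 S)
  hasCumulativeLimit : HasCumulativeLimit T S (fun N i => (T.grid N).increment I i -
    inner ℝ (ξ ((T.grid N).pt i)) ((T.grid N).increment X i)) 0

theorem IsPotentialOn.exists_isItoPrimitiveOn [CompleteSpace F] {X ξ : ℝ≥0 → F} {f : E → F → ℝ}
    {A : ℝ≥0 → E} (h : IsPotentialOn S X ξ f A) (hX : ContinuousOn X (Set.Icc 0 S))
    (hXX : HasQuadraticVariationOn T S X) :
    ∃ B : ℝ≥0 → ℝ, IsPotentialOn S X ξ (fun (p : E × ℝ) x => f p.1 x - p.2) (fun t => (A t, B t)) ∧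
      IsItoPrimitiveOn T S ξ X fun t => f (A t) (X t) - B t := by
  obtain ⟨B, hB⟩ := h.isC12Map.exists_hasCumulativeLimit_increment_sub_fderiv h.continuousOn
    h.boundedVariationOn hX hXX
  have B_zero : B 0 = 0 := tendsto_nhds_unique (hB.tendsto 0 zero_le) (by
    simp only [TimeGrid.steps_zero, Finset.sum_empty, tendsto_const_nhds])
  set c := f (A 0) (X 0)
  have hBc : ContinuousOn (fun t => B t + c) (Set.Icc 0 S) := hB.continuousOn.add continuousOn_const
  have hBc' : BoundedVariationOn (fun t => B t + c) (Set.Icc 0 S) :=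
    (isometry_add_right c).lipschitz.comp_boundedVariationOn hB.boundedVariationOn
  have hpot : IsPotentialOn S X ξ (fun (p : E × ℝ) x => f p.1 x - p.2)
      (fun t => (A t, B t + c)) :=
    ⟨h.isC12Map.sub_param, h.continuousOn.prodMk hBc,
      boundedVariationOn_prodMk h.boundedVariationOn hBc', fun t ht => by
        simp only [h.eq_gradient t ht, gradient, fderiv_sub_const]⟩
  refine ⟨_, hpot, by simp only [B_zero, zero_add, c, sub_self], hpot.continuousOn_apply hX, ?_⟩
  refine ((hB.sub (hasCumulativeLimit_increment hBc hBc')).congr_limit fun t _ => ?_).congr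
    fun N i hi => ?_
  · simp only [Pi.zero_apply, Pi.sub_apply, B_zero]
    ring
  · rw [h.eq_gradient _ (TimeGrid.pt_le_of_mem_steps hi), inner_gradient_left]
    simp only [Pi.sub_apply, TimeGrid.increment]
    ring

namespace IsItoPrimitiveOn

theorem congr {ξ X : ℝ≥0 → F} {I J : ℝ≥0 → ℝ} (hI : IsItoPrimitiveOn T S ξ X I)
    (h : Set.EqOn J I (Set.Icc 0 S)) : IsItoPrimitiveOn T S ξ X J where
  map_zero := (h ⟨le_rfl, zero_le⟩).trans hI.map_zero
  continuousOn := hI.continuousOn.congr h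
  hasCumulativeLimit := hI.hasCumulativeLimit.congr fun N i hi => by
    simp only [TimeGrid.increment, h ⟨zero_le, TimeGrid.mem_steps.1 hi⟩,
      h ⟨zero_le, TimeGrid.pt_le_of_mem_steps hi⟩]

theorem tendsto_riemannSum {d : ℕ} {ξ X : ℝ≥0 → EuclideanSpace ℝ (Fin d)} {I : ℝ≥0 → ℝ}
    (hI : IsItoPrimitiveOn T S ξ X I) {t : ℝ≥0} (ht : t ≤ S) :
    Tendsto (fun N => riemannSum (T.grid N) ξ X t) atTop (𝓝 (I t)) := by
  have := (T.tendsto_sum_increment hI.continuousOn ht).sub (hI.hasCumulativeLimit.tendsto t ht)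
  simp only [← Finset.sum_sub_distrib, sub_sub_cancel, hI.map_zero, Pi.zero_apply, sub_zero] at this
  exact this

theorem of_sum_smul {ι : Type*} [Fintype ι] {X : ℝ≥0 → F} {ξ : ι → ℝ≥0 → F}
    {Y η : ℝ≥0 → EuclideanSpace ℝ ι} {J : ℝ≥0 → ℝ}
    (hY : ∀ ℓ, IsItoPrimitiveOn T S (ξ ℓ) X fun t => Y t ℓ)
    (hη : ContinuousOn η (Set.Icc 0 S))
    (hJ : IsItoPrimitiveOn T S (fun t => ∑ ℓ, η t ℓ • ξ ℓ t) X J) :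
    IsItoPrimitiveOn T S η Y J where
  map_zero := hJ.map_zero
  continuousOn := hJ.continuousOn
  hasCumulativeLimit := by
    have error_ℓ (ℓ : ι) := (hY ℓ).hasCumulativeLimit.clm_apply_zero
      (φ := fun t => ContinuousLinearMap.mul ℝ ℝ (η t ℓ))
      ((ContinuousLinearMap.mul ℝ ℝ).continuous.comp_continuousOn
        ((EuclideanSpace.proj ℓ).continuous.comp_continuousOn hη))
    refine ((hJ.hasCumulativeLimit.sub (.sum Finset.univ fun ℓ _ => error_ℓ ℓ)).congr_limit
      fun t _ => ?_).congr fun N i _ => ?_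
    · simp
    · simp only [Pi.sub_apply, Finset.sum_apply, ContinuousLinearMap.mul_apply', mul_sub,
        Finset.sum_sub_distrib, sum_inner, real_inner_smul_left, PiLp.inner_apply]
      simp only [TimeGrid.increment, mul_comm, RCLike.inner_apply, conj_trivial, PiLp.sub_apply]
      ring

end IsItoPrimitiveOn

end ItoPrimitives

namespace IsAdmissible

variable {T : GridSequence} {d ν : ℕ} {X : ℝ≥0 → EuclideanSpace ℝ (Fin d)}

theorem exists_isPotentialOn_isItoPrimitiveOn {ξ : ℝ≥0 → EuclideanSpace ℝ (Fin d)}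
    (hξ : IsAdmissible X ξ) (hX : IsIntegrator T X) {S : ℝ≥0} (hS : 0 < S) :
    ∃ (n : ℕ) (f : EuclideanSpace ℝ (Fin n) × ℝ → EuclideanSpace ℝ (Fin d) → ℝ)
      (A : ℝ≥0 → EuclideanSpace ℝ (Fin n) × ℝ), IsPotentialOn S X ξ f A ∧
      IsItoPrimitiveOn T S ξ X (fun t => f (A t) (X t)) ∧
      ∀ t ≤ S, itoIntegral T ξ X t = f (A t) (X t) := by
  obtain ⟨_, _, _, h⟩ := isAdmissible_iff.1 hξ S hS
  obtain ⟨_, hpot, hprim⟩ :=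
    h.exists_isItoPrimitiveOn hX.1.continuousOn (hX.hasQuadraticVariationOn S)
  exact ⟨_, _, _, hpot, hprim, fun _ ht => (hprim.tendsto_riemannSum ht).limUnder_eq⟩

theorem isItoPrimitiveOn {ξ : ℝ≥0 → EuclideanSpace ℝ (Fin d)} (hξ : IsAdmissible X ξ)
    (hX : IsIntegrator T X) {S : ℝ≥0} (hS : 0 < S) :
    IsItoPrimitiveOn T S ξ X (itoIntegral T ξ X) :=
  let ⟨_, _, _, _, hprim, heq⟩ := hξ.exists_isPotentialOn_isItoPrimitiveOn hX hS
  hprim.congr fun t ht => heq t ht.2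

theorem tendsto_riemannSum {ξ : ℝ≥0 → EuclideanSpace ℝ (Fin d)} (hξ : IsAdmissible X ξ)
    (hX : IsIntegrator T X) (t : ℝ≥0) :
    Tendsto (fun N => riemannSum (T.grid N) ξ X t) atTop (𝓝 (itoIntegral T ξ X t)) :=
  (hξ.isItoPrimitiveOn hX (S := t + 1) (by positivity)).tendsto_riemannSum
    (le_add_of_nonneg_right zero_le_one)

variable {ξ : Fin ν → ℝ≥0 → EuclideanSpace ℝ (Fin d)} {Y η : ℝ≥0 → EuclideanSpace ℝ (Fin ν)}

theorem sum_smul (hX : IsIntegrator T X) (hξ : ∀ ℓ, IsAdmissible X (ξ ℓ))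
    (hY : ∀ ℓ t, Y t ℓ = itoIntegral T (ξ ℓ) X t) (hη : IsAdmissible Y η) :
    IsAdmissible X fun t => ∑ ℓ, η t ℓ • ξ ℓ t := by
  refine isAdmissible_iff.2 fun S hS => ?_
  obtain ⟨_, _, _, hg⟩ := isAdmissible_iff.1 hη S hS
  choose n f A hf _ hI using fun ℓ => (hξ ℓ).exists_isPotentialOn_isItoPrimitiveOn hX hS
  exact (IsPotentialOn.sum_smul hf (fun ℓ t ht => (hY ℓ t).trans (hI ℓ t ht)) hg).exists_euclidean

theorem isItoPrimitiveOn_itoIntegral_sum_smul (hX : IsIntegrator T X)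
    (hξ : ∀ ℓ, IsAdmissible X (ξ ℓ)) (hY : ∀ ℓ t, Y t ℓ = itoIntegral T (ξ ℓ) X t)
    (hη : IsAdmissible Y η) {S : ℝ≥0} (hS : 0 < S) :
    IsItoPrimitiveOn T S η Y (itoIntegral T (fun t => ∑ ℓ, η t ℓ • ξ ℓ t) X) := by
  have hYprim (ℓ : Fin ν) : IsItoPrimitiveOn T S (ξ ℓ) X fun t => Y t ℓ :=
    ((hξ ℓ).isItoPrimitiveOn hX hS).congr fun t _ => hY ℓ t
  have hYc : ContinuousOn Y (Set.Icc 0 S) :=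
    (EuclideanSpace.equiv (Fin ν) ℝ).symm.continuous.comp_continuousOn
      (continuousOn_pi.2 fun ℓ => (hYprim ℓ).continuousOn)
  obtain ⟨_, _, _, hg⟩ := isAdmissible_iff.1 hη S hS
  exact .of_sum_smul hYprim (hg.continuousOn_integrand hYc)
    ((sum_smul hX hξ hY hη).isItoPrimitiveOn hX hS)

end IsAdmissible

end PathwiseIto

theorem theorem5 (T : GridSequence) {d ν : ℕ}
    (X : ℝ≥0 → EuclideanSpace ℝ (Fin d)) (hX : IsIntegrator T X)
    (ξ : Fin ν → ℝ≥0 → EuclideanSpace ℝ (Fin d)) (hξ : ∀ ℓ, IsAdmissible X (ξ ℓ))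
    (Y : ℝ≥0 → EuclideanSpace ℝ (Fin ν)) (hY : ∀ ℓ t, Y t ℓ = itoIntegral T (ξ ℓ) X t)
    (η : ℝ≥0 → EuclideanSpace ℝ (Fin ν)) (hη : IsAdmissible Y η) :
    (∀ ℓ, ItoIntegrable T (ξ ℓ) X) ∧
    IsAdmissible X (fun t => ∑ ℓ, η t ℓ • ξ ℓ t) ∧
    ItoIntegrable T η Y ∧
    ItoIntegrable T (fun t => ∑ ℓ, η t ℓ • ξ ℓ t) X ∧
    ∀ t, itoIntegral T η Y t = itoIntegral T (fun s => ∑ ℓ, η s ℓ • ξ ℓ s) X t := by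
  have hηξ := IsAdmissible.sum_smul hX hξ hY hη
  have tendsto_riemannSum_Y (t : ℝ≥0) : Tendsto (fun N => riemannSum (T.grid N) η Y t) atTop
      (𝓝 (itoIntegral T (fun s => ∑ ℓ, η s ℓ • ξ ℓ s) X t)) :=
    (IsAdmissible.isItoPrimitiveOn_itoIntegral_sum_smul hX hξ hY hη
      (S := t + 1) (by positivity)).tendsto_riemannSum (le_add_of_nonneg_right zero_le_one)
  exact ⟨fun ℓ t => ⟨_, (hξ ℓ).tendsto_riemannSum hX t⟩, hηξ,
    fun t => ⟨_, tendsto_riemannSum_Y t⟩, fun t => ⟨_, hηξ.tendsto_riemannSum hX t⟩,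
    fun t => (tendsto_riemannSum_Y t).limUnder_eq⟩
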